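/- Let $0<T<\infty$ and let $(\Omega,\mathcal F,(\mathcal F_t)_{t\in[0,T]},\mathrm P)$ be a filtered probability space with right-continuous filtration such that $\mathcal F_0$ contains all null sets of $\mathcal F$ and every $A\in\mathcal F_0$ satisfies $\mathrm P(A)\in\{0,1\}$. Let $(Y_t)_{t\in[0,T]}$ be a right-continuous, nonnegative, adapted real-valued process with bounded paths, and put $Y^*=\sup_{t\in[0,T]}Y_t$. Let $g:[0,1]\to[0,1]$ be a distortion function, i.e. nondecreasing with $g(0)=0$ and $g(1)=1$. For a real random variable $X$ with distribution function $F_X$ put $$\mathcal E^g(X)=\int_0^\infty g(1-F_X(x))\,dx-\int_{-\infty}^0\bigl[1-g(1-F_X(x))\bigr]\,dx ,$$ and let $\mathcal X_g$ be the set of random variables $X$ on $(\Omega,\mathcal F,\mathrm P)$ with $\int_0^\infty g(1-F_{|X|}(x))\,dx<\infty$. Let $\mathcal T$ be the set of all stopping times $\tau:\Omega\to[0,T]$ with respect to $(\mathcal F_t)$. Let $\mathcal T^r$ be the set of all randomized stopping times with values in $[0,T]$, that is, of all maps $\tau^r:\Omega\times[0,1]\to[0,T]$ such that $\tau^r(\omega,\cdot)$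 is nondecreasing and left-continuous for every $\omega\in\Omega$ and $\tau^r(\cdot,u)$ is a stopping time for every $u\in[0,1]$. For $\tau^r\in\mathcal T^r$ write $Y^r_{\tau^r}(\omega,u)=Y_{\tau^r(\omega,u)}(\omega)$, a random variable on $\Omega\times[0,1]$ under the product of $\mathrm P$ and the uniform distribution on $[0,1]$. **Proposition.** Assume that for every $t\in\,]0,T]$ the probability space $(\Omega,\mathcal F_t,\mathrm P|_{\mathcal F_t})$ is atomless and $\mathcal F_t$ is countably generated up to null sets (there is a countably generated $\sigma$-algebra $\mathcal G\subseteq\mathcal F_t$ such that every $A\in\mathcal F_t$ coincides with some $B\in\mathcal G$ up to a $\mathrm P$-null set). If $g$ is continuous and concave and $Y^*\in\mathcal X_g$, then $$\sup_{\tau^r\in\mathcal T^r}\mathcal E^g\bigl(Y^r_{\tau^r}\bigr)=\sup_{\tau\in\mathcal T}\mathcal E^g(Y_\tau).$$ -/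

import Mathlib

open MeasureTheory Set
open scoped ENNReal

noncomputable section

namespace DistortedStopping

/-- A distortion function: a nondecreasing function on `[0,1]` with `g 0 = 0` and `g 1 = 1`
(only the values on `[0,1]` matter). -/
structure IsDistortion (g : ℝ → ℝ) : Prop where
  monotoneOn : MonotoneOn g (Icc 0 1)
  map_zero : g 0 = 0
  map_one : g 1 = 1

/-- The distribution function `F_X(x) = P(X ≤ x)`. -/
def distFun {S : Type*} [MeasurableSpace S] (P : Measure S) (X : S → ℝ) (x : ℝ) : ℝ :=
  P.real {ω | X ω ≤ x}

/-- The distorted expectation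
`∫_0^∞ g(1 - F_X(x)) dx - ∫_{-∞}^0 [1 - g(1 - F_X(x))] dx`, as an extended real number.
Both integrands are nonnegative for a distortion function `g`. -/
def distortedExp {S : Type*} [MeasurableSpace S] (g : ℝ → ℝ) (P : Measure S) (X : S → ℝ) :
    EReal :=
  ((∫⁻ x in Ioi (0 : ℝ), ENNReal.ofReal (g (1 - distFun P X x)) : ℝ≥0∞) : EReal) -
    ((∫⁻ x in Iio (0 : ℝ), ENNReal.ofReal (1 - g (1 - distFun P X x)) : ℝ≥0∞) : EReal)

/-- The set `𝒳_g` of random variables `X` with `∫_0^∞ g(1 - F_{|X|}(x)) dx < ∞`. -/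
def spaceX {S : Type*} [MeasurableSpace S] (g : ℝ → ℝ) (P : Measure S) : Set (S → ℝ) :=
  {X | Measurable X ∧
    ∫⁻ x in Ioi (0 : ℝ), ENNReal.ofReal (g (1 - distFun P (fun ω => |X ω|) x)) < ∞}

/-- `(Ω, m, P|_m)` is atomless: every event in `m` of positive probability contains an event
in `m` of strictly smaller positive probability. -/
def Atomless {Ω : Type*} {mΩ : MeasurableSpace Ω} (P : Measure[mΩ] Ω) (m : MeasurableSpace Ω) :
    Prop :=
  ∀ A, MeasurableSet[m] A → 0 < P A →
    ∃ B, B ⊆ A ∧ MeasurableSet[m] B ∧ 0 < P B ∧ P B < P A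

/-- The σ-algebra `m` is countably generated up to null sets: some countably generated
sub-σ-algebra of `m` contains every set of `m` modulo a `P`-null set. -/
def CountablyGeneratedModNull {Ω : Type*} {mΩ : MeasurableSpace Ω} (P : Measure[mΩ] Ω)
    (m : MeasurableSpace Ω) : Prop :=
  ∃ m₀ : MeasurableSpace Ω, m₀ ≤ m ∧ @MeasurableSpace.CountablyGenerated Ω m₀ ∧
    ∀ A, MeasurableSet[m] A → ∃ B, MeasurableSet[m₀] B ∧ A =ᵐ[P] B

/-- The set `𝒯` of stopping times with values in `[0,T]`. -/
def stoppingTimes {Ω : Type*} {mΩ : MeasurableSpace Ω} {T : ℝ}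
    (𝓕 : Filtration (Icc (0 : ℝ) T) mΩ) : Set (Ω → Icc (0 : ℝ) T) :=
  {τ | IsStoppingTime 𝓕 (fun ω => (τ ω : WithTop (Icc (0 : ℝ) T)))}

/-- The set `𝒯ʳ` of randomized stopping times with values in `[0,T]`: maps `τ(ω,u)` that are
nondecreasing and left-continuous in `u ∈ [0,1]` and such that each `τ(·,u)` is a stopping
time. -/
def randomizedStoppingTimes {Ω : Type*} {mΩ : MeasurableSpace Ω} {T : ℝ}
    (𝓕 : Filtration (Icc (0 : ℝ) T) mΩ) : Set (Ω → unitInterval → Icc (0 : ℝ) T) :=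
  {τ | (∀ ω, Monotone (τ ω)) ∧ (∀ ω u, ContinuousWithinAt (τ ω) (Iic u) u) ∧
    ∀ u, (fun ω => τ ω u) ∈ stoppingTimes 𝓕}

end DistortedStopping

end

open MeasureTheory Set Filter Topology
open scoped ENNReal

namespace DistortedStopping

/-!
# Randomized stopping times do not improve distorted stopping

For continuous `g`, the distorted expectation of a nonnegative variable is lower semicontinuous
under convergence in law, by Fatou's lemma. It therefore suffices to approximate the law of a
randomly stopped reward by laws of stopped rewards. After discretizing time to a grid avoiding `0`
and the randomization to finitely many values, the randomization is replaced by a label measurable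
at the first grid time and asymptotically independent of the relevant events; such labels exist
because the σ-algebra at that time is atomless. This argument needs neither concavity of `g` nor
countable generation nor integrability of the maximal reward.
-/

/-! ### Splitting sets of an atomless σ-algebra -/

section Atomless

variable {Ω : Type*} {m mΩ : MeasurableSpace Ω} {P : Measure Ω}

/-! A stopping time is a randomized one that is constant in `u`, so only "≤" has content, and for it
one-sided control of tails suffices: by `tailIntegral_le_liminf`, bounding `tail` from above by the
lower limit of the approximating tails is enough.

With the mesh `T/(n+1)` and the number `N+1` of cells fixed, rounding the randomized time up to the
grid and sampling it at left cell endpoints gives a uniform mixture of finitely many stopping times,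
none before `T/(n+1)`. `Atomless.exists_approx_uniform` imitates the mixing variable by a label
known at time `T/(n+1)`, hence no later than any candidate stops, so following the label is a
stopping time.

The limits must then be taken in the order `N → ∞`, `n → ∞`. For a fixed mesh, left-continuity in
`u` makes the rounded time eventually constant in `N`, so no left-continuity of the paths is needed.
Refining the mesh approaches the time from the right, where the paths are continuous. -/

theorem Atomless.exists_subset_measure_le [IsFiniteMeasure P] (h : Atomless P m) (hm : m ≤ mΩ)
    {A : Set Ω} (hA : MeasurableSet[m] A) (hpos : 0 < P A) {ε : ℝ≥0∞} (hε : 0 < ε) :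
    ∃ B, B ⊆ A ∧ MeasurableSet[m] B ∧ 0 < P B ∧ P B ≤ ε := by
  -- Split the current set and keep the smaller piece: each split at least halves the measure.
  have key : ∀ n : ℕ, ∃ B, B ⊆ A ∧ MeasurableSet[m] B ∧ 0 < P B ∧ 2 ^ n * P B ≤ P A := by
    intro n
    induction n with
    | zero => exact ⟨A, Subset.rfl, hA, hpos, by simp⟩
    | succ n ih =>
      obtain ⟨B, hBA, hB, hB0, hBn⟩ := ih
      obtain ⟨C, hCB, hC, hC0, hClt⟩ := h B hB hB0
      have hadd : P C + P (B \ C) = P B := by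
        rw [← measure_inter_add_sdiff B (hm _ hC), inter_eq_self_of_subset_right hCB]
      have hD0 : 0 < P (B \ C) := by
        rw [pos_iff_ne_zero]
        intro h0
        rw [h0, add_zero] at hadd
        exact hClt.ne hadd
      rcases le_total (P C) (P (B \ C)) with hle | hle
      · refine ⟨C, hCB.trans hBA, hC, hC0, le_trans ?_ hBn⟩
        rw [pow_succ, mul_assoc]
        gcongr
        rw [two_mul, ← hadd]
        gcongr
      · refine ⟨B \ C, sdiff_subset.trans hBA, hB.diff hC, hD0, le_trans ?_ hBn⟩
        rw [pow_succ, mul_assoc]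
        gcongr
        rw [two_mul, ← hadd]
        gcongr
  obtain ⟨n, hn⟩ : ∃ n : ℕ, P A / ε < n := ENNReal.exists_nat_gt
    (ENNReal.div_lt_top (measure_ne_top P A) hε.ne').ne
  obtain ⟨B, hBA, hB, hB0, hBn⟩ := key n
  refine ⟨B, hBA, hB, hB0, ?_⟩
  by_contra! hlt
  have h1 : P A < n * ε := by
    rw [ENNReal.div_lt_iff (Or.inl hε.ne') (Or.inr (measure_ne_top P A))] at hn
    exact hn
  have h2 : (n : ℝ≥0∞) * ε ≤ 2 ^ n * P B := by
    gcongr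
    exact_mod_cast (Nat.lt_two_pow_self (n := n)).le
  exact absurd (h1.trans_le (h2.trans hBn)) (lt_irrefl _)

/-- Sierpiński's theorem: an atomless finite measure attains all intermediate values. -/
theorem Atomless.exists_subset_measure_eq [IsFiniteMeasure P] (h : Atomless P m) (hm : m ≤ mΩ)
    {A : Set Ω} (hA : MeasurableSet[m] A) {c : ℝ} (hc0 : 0 ≤ c) (hc : c ≤ P.real A) :
    ∃ B, B ⊆ A ∧ MeasurableSet[m] B ∧ P.real B = c := by
  let S : Set (Set Ω) := {B | B ⊆ A ∧ MeasurableSet[m] B ∧ P.real B ≤ c}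
  -- Greedy exhaustion: rewritten as `P C - P B ≤ 2 (P B' - P B)`, the inequality says that `B'`
  -- realizes at least half of the gain still possible inside `S`. Iterating leaves no room for
  -- enlarging the union.
  have hstep : ∀ B : S, ∃ B' : S, (B : Set Ω) ⊆ B' ∧
      ∀ C ∈ S, (B : Set Ω) ⊆ C → P.real C + P.real B ≤ 2 * P.real (B' : Set Ω) := by
    intro B
    let V : Set ℝ := (fun C => P.real C) '' {C | C ∈ S ∧ (B : Set Ω) ⊆ C}
    have hne : V.Nonempty := ⟨_, B, ⟨B.2, Subset.rfl⟩, rfl⟩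
    have hbdd : BddAbove V := ⟨c, by rintro _ ⟨C, hC, rfl⟩; exact hC.1.2.2⟩
    have hBV : P.real B ≤ sSup V := le_csSup hbdd ⟨B, ⟨B.2, Subset.rfl⟩, rfl⟩
    rcases hBV.eq_or_lt with heq | hlt
    · refine ⟨B, Subset.rfl, fun C hC hBC => ?_⟩
      have := le_csSup hbdd (mem_image_of_mem (fun C => P.real C) (⟨hC, hBC⟩ :
        C ∈ {C | C ∈ S ∧ (B : Set Ω) ⊆ C}))
      change P.real C ≤ sSup V at this
      linarith
    · obtain ⟨_, ⟨B', hB', rfl⟩, hB'2⟩ := exists_lt_of_lt_csSup hne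
        (show (sSup V + P.real B) / 2 < sSup V by linarith)
      refine ⟨⟨B', hB'.1⟩, hB'.2, fun C hC hBC => ?_⟩
      have := le_csSup hbdd (mem_image_of_mem (fun C => P.real C) (⟨hC, hBC⟩ :
        C ∈ {C | C ∈ S ∧ (B : Set Ω) ⊆ C}))
      change P.real C ≤ sSup V at this
      dsimp only at hB'2 ⊢
      linarith
  choose next hnext_sub hnext using hstep
  let seq : ℕ → S := fun n => Nat.rec ⟨∅, empty_subset _, @MeasurableSet.empty Ω m, by simpa⟩
    (fun _ B => next B) n
  have hmono : Monotone fun n : ℕ => (seq n).1 := by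
    refine monotone_nat_of_le_succ (f := fun n => (seq n).1) fun n => ?_
    exact hnext_sub (seq n)
  let U : Set Ω := ⋃ n, (seq n).1
  have hUA : U ⊆ A := iUnion_subset fun n => (seq n).2.1
  have hU : MeasurableSet[m] U := MeasurableSet.iUnion fun n => (seq n).2.2.1
  have hlim : Tendsto (fun n => P.real (seq n).1) atTop (𝓝 (P.real U)) :=
    (ENNReal.tendsto_toReal (measure_ne_top P U)).comp (tendsto_measure_iUnion_atTop hmono)
  have hUc : P.real U ≤ c := le_of_tendsto' hlim fun n => (seq n).2.2.2
  refine ⟨U, hUA, hU, hUc.antisymm ?_⟩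
  by_contra! hlt
  have hdiff : P.real (A \ U) = P.real A - P.real U := measureReal_sdiff hUA (hm _ hU)
  have hdiff0 : 0 < P (A \ U) := by
    rw [pos_iff_ne_zero]
    intro h0
    rw [measureReal_def, h0, ENNReal.toReal_zero] at hdiff
    linarith
  obtain ⟨C, hCA, hC, hC0, hCle⟩ := h.exists_subset_measure_le hm (hA.diff hU) hdiff0
    (ENNReal.ofReal_pos.2 (sub_pos.2 hlt))
  have hCc : P.real C ≤ c - P.real U := by
    have := ENNReal.toReal_mono ENNReal.ofReal_ne_top hCle
    rwa [ENNReal.toReal_ofReal (sub_nonneg.2 hUc)] at this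
  have hCpos : 0 < P.real C := ENNReal.toReal_pos hC0.ne' (measure_ne_top P C)
  have hUC : P.real (U ∪ C) = P.real U + P.real C :=
    measureReal_union (disjoint_sdiff_self_right.mono_right hCA) (hm _ hC)
  have hmem : U ∪ C ∈ S :=
    ⟨union_subset hUA (hCA.trans sdiff_subset), hU.union hC, by rw [hUC]; linarith⟩
  -- In the limit `P (U ∪ C) ≤ P U`, although `C` has positive measure and is disjoint from `U`.
  have hle : ∀ n, P.real (U ∪ C) + P.real (seq n).1 ≤ 2 * P.real U := fun n =>
    (hnext (seq n) _ hmem ((subset_iUnion (fun n => (seq n).1) n).trans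
      subset_union_left)).trans (by
        have : P.real (next (seq n) : Set Ω) ≤ P.real U :=
          measureReal_mono (subset_iUnion (fun n => (seq n).1) (n + 1))
        linarith)
  have := le_of_tendsto' (hlim.const_add (P.real (U ∪ C))) hle
  linarith

/-- An atomless σ-algebra supports disjoint pieces of `A` of the same prescribed measure. -/
theorem Atomless.exists_labelling [IsFiniteMeasure P] (h : Atomless P m) (hm : m ≤ mΩ)
    {c : ℝ} (hc0 : 0 ≤ c) (N : ℕ) : ∀ {A : Set Ω}, MeasurableSet[m] A → N * c ≤ P.real A →
    ∃ V : Ω → ℕ, Measurable[m] V ∧ ∀ j < N, P.real (A ∩ V ⁻¹' {j}) = c := by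
  induction N with
  | zero => exact fun _ _ => ⟨fun _ => 0, measurable_const, fun j hj => absurd hj (by simp)⟩
  | succ N ih =>
    intro A hA hc
    push_cast at hc
    have hNc : 0 ≤ N * c := by positivity
    obtain ⟨B, hBA, hB, hBc⟩ := h.exists_subset_measure_eq hm hA hc0 (by linarith)
    have hdiff : P.real (A \ B) = P.real A - P.real B := measureReal_sdiff hBA (hm _ hB)
    obtain ⟨V, hV, hVc⟩ := ih (hA.diff hB) (by rw [hdiff]; linarith)
    classical
    -- The new piece gets label `0` and the old labels shift up by one, so whatever is left over
    -- ends with label `N`, outside the prescribed range.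
    refine ⟨fun ω => if ω ∈ B then 0 else V ω + 1,
      Measurable.ite hB measurable_const (hV.add_const 1), fun j hj => ?_⟩
    cases j with
    | zero =>
      rw [← hBc]
      congr 1
      ext ω
      by_cases hω : ω ∈ B
      · simp [hω, hBA hω]
      · simp [hω]
    | succ j =>
      rw [← hVc j (by omega)]
      congr 1
      ext ω
      by_cases hω : ω ∈ B <;> simp [hω]

/-- In an atomless sub-σ-algebra there are `N`-valued labels that are approximately uniform and
independent of finitely many given events. -/
theorem Atomless.exists_approx_uniform [IsProbabilityMeasure P] (h : Atomless P m) (hm : m ≤ mΩ)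
    {ι : Type*} [Finite ι] (D : ι → Set Ω) {N : ℕ} (hN : 0 < N) {M : ℕ} (hM : 0 < M) :
    ∃ V : Ω → ℕ, Measurable[m] V ∧
      ∀ i, ∀ j < N, P.real (D i) / N - 1 / M ≤ P.real (V ⁻¹' {j} ∩ D i) := by
  -- The events need not be measurable. A measurable hull has the same measure on every set of `m`,
  -- so its conditional probability `f i` serves for `D i`.
  let D' : ι → Set Ω := fun i => toMeasurable P (D i)
  have hD' : ∀ i, MeasurableSet (D' i) := fun i => measurableSet_toMeasurable P (D i)
  let f : ι → Ω → ℝ := fun i => P[(D' i).indicator (fun _ => (1 : ℝ)) | m]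
  have hint : ∀ i, Integrable ((D' i).indicator fun _ => (1 : ℝ)) P := fun i =>
    (integrable_const _).indicator (hD' i)
  have hf : ∀ i A, MeasurableSet[m] A → ∫ ω in A, f i ω ∂P = P.real (A ∩ D i) := by
    intro i A hA
    rw [setIntegral_condExp hm (hint i) hA, setIntegral_indicator (hD' i)]
    simp only [setIntegral_const, smul_eq_mul, mul_one]
    rw [measureReal_def, measureReal_def, inter_comm, Measure.measure_toMeasurable_inter (hm _ hA)
      (measure_ne_top P _), inter_comm]
  have hfm : ∀ i, Measurable[m] (f i) := fun i => stronglyMeasurable_condExp.measurable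
  -- On one cell every `f i` varies by at most `1/M`. Splitting the cell into `N` equal parts
  -- therefore splits each `D i` almost equally as well. There are countably many cells because `ι`
  -- is finite.
  let cell : Ω → ι → ℤ := fun ω i => ⌊M * f i ω⌋
  have hcell : Measurable[m] cell := by
    refine @measurable_pi_lambda _ _ _ m _ _ fun i => ?_
    exact Int.measurable_floor.comp ((hfm i).const_mul (M : ℝ))
  have hE : ∀ z, MeasurableSet[m] (cell ⁻¹' {z}) := fun z => hcell (measurableSet_singleton z)
  have hlab : ∀ z : ι → ℤ, ∃ V : Ω → ℕ, Measurable[m] V ∧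
      ∀ j < N, P.real (cell ⁻¹' {z} ∩ V ⁻¹' {j}) = P.real (cell ⁻¹' {z}) / N := fun z =>
    h.exists_labelling hm (by positivity) N (hE z) (by field_simp; exact le_rfl)
  choose W hW hWN using hlab
  let V : Ω → ℕ := fun ω => W (cell ω) ω
  have hV : Measurable[m] V :=
    (@measurable_from_prod_countable_right _ _ _ _ m _ _ _ (fun p : (ι → ℤ) × Ω => W p.1 p.2)
      hW).comp (@Measurable.prodMk _ _ _ _ _ m _ _ hcell (@measurable_id _ m))
  refine ⟨V, hV, fun i j hj => ?_⟩
  have hN' : (0 : ℝ) < N := by exact_mod_cast hN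
  have hM' : (0 : ℝ) < M := by exact_mod_cast hM
  have hVE : ∀ z, cell ⁻¹' {z} ∩ V ⁻¹' {j} = cell ⁻¹' {z} ∩ W z ⁻¹' {j} := by
    intro z
    ext ω
    simp only [mem_inter_iff, mem_preimage, mem_singleton_iff, V]
    constructor <;> rintro ⟨rfl, h2⟩ <;> exact ⟨rfl, h2⟩
  -- Each cell loses at most `1/M` of its own measure, so the total loss over all cells is at most
  -- `1/M`.
  have hloc : ∀ z, P.real (cell ⁻¹' {z} ∩ D i) / N ≤
      P.real (cell ⁻¹' {z} ∩ (V ⁻¹' {j} ∩ D i)) + P.real (cell ⁻¹' {z}) / M := by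
    intro z
    have hEj : MeasurableSet[m] (cell ⁻¹' {z} ∩ V ⁻¹' {j}) :=
      (hE z).inter (hV (measurableSet_singleton j))
    have hfint : Integrable (f i) P := integrable_condExp
    have hpt : ∀ ω ∈ cell ⁻¹' {z}, (z i : ℝ) / M ≤ f i ω ∧ f i ω ≤ (z i + 1) / M := by
      intro ω hω
      have hz : ⌊M * f i ω⌋ = z i := congrFun hω i
      rw [Int.floor_eq_iff] at hz
      constructor
      · rw [div_le_iff₀ hM']; linarith [hz.1]
      · rw [le_div_iff₀ hM']; linarith [hz.2]
    have h1 : P.real (cell ⁻¹' {z} ∩ D i) ≤ (z i + 1) / M * P.real (cell ⁻¹' {z}) := by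
      rw [← hf i _ (hE z)]
      calc ∫ ω in cell ⁻¹' {z}, f i ω ∂P ≤ ∫ _ in cell ⁻¹' {z}, ((z i : ℝ) + 1) / M ∂P :=
            setIntegral_mono_on hfint.integrableOn (integrable_const _) (hm _ (hE z))
              fun ω hω => (hpt ω hω).2
        _ = _ := by simp [mul_comm]
    have h2 : (z i : ℝ) / M * (P.real (cell ⁻¹' {z}) / N) ≤
        P.real (cell ⁻¹' {z} ∩ (V ⁻¹' {j} ∩ D i)) := by
      rw [← inter_assoc, ← hf i _ hEj, ← hWN z j hj, ← hVE]
      calc _ = ∫ _ in cell ⁻¹' {z} ∩ V ⁻¹' {j}, (z i : ℝ) / M ∂P := by simp [mul_comm]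
        _ ≤ _ := setIntegral_mono_on (integrable_const _) hfint.integrableOn (hm _ hEj)
              fun ω hω => (hpt ω hω.1).1
    have h3 : P.real (cell ⁻¹' {z} ∩ D i) / N ≤
        (z i : ℝ) / M * (P.real (cell ⁻¹' {z}) / N) + P.real (cell ⁻¹' {z}) / M / N := by
      rw [div_le_iff₀ hN']
      calc _ ≤ _ := h1
        _ = _ := by field_simp
    have h4 : P.real (cell ⁻¹' {z}) / M / N ≤ P.real (cell ⁻¹' {z}) / M :=
      div_le_self (by positivity) (by exact_mod_cast hN)
    linarith
  have hsum : ∀ A : Set Ω, HasSum (fun z => P.real (cell ⁻¹' {z} ∩ A)) (P.real A) := by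
    intro A
    have h1 : ∑' z, P (cell ⁻¹' {z} ∩ A) = P A := by
      have := tsum_measure_preimage_singleton (μ := P.restrict A) (f := cell)
        (countable_univ (α := ι → ℤ)) fun z _ => hm _ (hE z)
      rw [preimage_univ, Measure.restrict_apply_univ,
        tsum_univ (fun z => P.restrict A (cell ⁻¹' {z}))] at this
      rw [← this]
      exact tsum_congr fun z => (Measure.restrict_apply (hm _ (hE z))).symm
    have h2 := ENNReal.hasSum_toReal (f := fun z => P (cell ⁻¹' {z} ∩ A))
      (by rw [h1]; exact measure_ne_top P A)
    rwa [← ENNReal.tsum_toReal_eq (fun z => measure_ne_top P _), h1] at h2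
  have hfin := hasSum_le hloc ((hsum (D i)).div_const (N : ℝ))
    ((hsum (V ⁻¹' {j} ∩ D i)).add (((by simpa using hsum univ :
      HasSum (fun z => P.real (cell ⁻¹' {z})) 1)).div_const (M : ℝ)))
  linarith

end Atomless

/-! ### Lower semicontinuity of the distorted expectation -/

/-- The upper tail `x ↦ P(X > x)`. -/
noncomputable def tail {S : Type*} [MeasurableSpace S] (P : Measure S) (X : S → ℝ) (x : ℝ) : ℝ :=
  P.real {ω | x < X ω}

/-- The integral `∫_0^∞ g(P(X > x)) dx`. -/
noncomputable def tailIntegral {S : Type*} [MeasurableSpace S] (g : ℝ → ℝ) (P : Measure S)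
    (X : S → ℝ) : ℝ≥0∞ :=
  ∫⁻ x in Ioi (0 : ℝ), ENNReal.ofReal (g (tail P X x))

section Tail

variable {S : Type*} [MeasurableSpace S] {μ : Measure S}
  {S' : Type*} [MeasurableSpace S'] {ν : Measure S'} [IsProbabilityMeasure ν] {g : ℝ → ℝ}

theorem distortedExp_of_nonneg (hg : IsDistortion g) {X : S → ℝ} (hX : ∀ ω, 0 ≤ X ω) :
    distortedExp g μ X =
      ((∫⁻ x in Ioi (0 : ℝ), ENNReal.ofReal (g (1 - distFun μ X x)) : ℝ≥0∞) : EReal) := by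
  have h0 : ∫⁻ x in Iio (0 : ℝ), ENNReal.ofReal (1 - g (1 - distFun μ X x)) = 0 := by
    rw [setLIntegral_congr_fun (g := fun _ => 0) measurableSet_Iio, lintegral_zero]
    intro x hx
    have : {ω | X ω ≤ x} = ∅ := by
      ext ω
      simpa using (mem_Iio.1 hx).trans_le (hX ω)
    simp [distFun, this, hg.map_one]
  rw [distortedExp, h0]
  simp

variable [IsProbabilityMeasure μ]

theorem tail_mem_Icc (X : S → ℝ) (x : ℝ) : tail μ X x ∈ Icc (0 : ℝ) 1 :=
  ⟨measureReal_nonneg, measureReal_le_one⟩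

theorem antitone_tail (X : S → ℝ) : Antitone (tail μ X) := fun _ _ hxy =>
  measureReal_mono fun _ hω => lt_of_le_of_lt hxy hω

/-- Subadditivity alone gives `1 - F ≤ tail`, so no measurability of `X` is needed; this serves for
the randomly stopped reward on the product space. -/
theorem distortedExp_le_tailIntegral (hg : IsDistortion g) {X : S → ℝ} (hX : ∀ ω, 0 ≤ X ω) :
    distortedExp g μ X ≤ (tailIntegral g μ X : EReal) := by
  rw [distortedExp_of_nonneg hg hX, EReal.coe_ennreal_le_coe_ennreal_iff]
  refine lintegral_mono fun x => ENNReal.ofReal_le_ofReal (hg.monotoneOn ?_ (tail_mem_Icc X x) ?_)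
  · exact ⟨sub_nonneg.2 measureReal_le_one, sub_le_self _ measureReal_nonneg⟩
  · have h1 : {ω | X ω ≤ x} ∪ {ω | x < X ω} = univ := by
      ext ω
      simpa using le_or_gt (X ω) x
    have h2 := measureReal_union_le (μ := μ) {ω | X ω ≤ x} {ω | x < X ω}
    rw [h1, probReal_univ] at h2
    simp only [distFun, tail]
    linarith

theorem distortedExp_eq_tailIntegral (hg : IsDistortion g) {X : S → ℝ} (hX : ∀ ω, 0 ≤ X ω)
    (hXm : Measurable X) : distortedExp g μ X = (tailIntegral g μ X : EReal) := by
  rw [distortedExp_of_nonneg hg hX, tailIntegral]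
  refine congrArg _ (lintegral_congr fun x => ?_)
  rw [distFun, tail, ← probReal_compl_eq_one_sub (measurableSet_le hXm measurable_const)]
  simp only [compl_ofPred, not_le]

/-- Lower semicontinuity of the distorted expectation for continuous `g`. -/
theorem tailIntegral_le_liminf (hg : IsDistortion g) (hgc : ContinuousOn g (Icc 0 1))
    {X : S → ℝ} {Z : ℕ → S' → ℝ}
    (h : ∀ x, ∀ c < tail μ X x, ∀ᶠ n in atTop, c < tail ν (Z n) x) :
    tailIntegral g μ X ≤ liminf (fun n => tailIntegral g ν (Z n)) atTop := by
  have hmeas : ∀ n, Measurable fun x => ENNReal.ofReal (g (tail ν (Z n) x)) := fun n =>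
    Antitone.measurable fun x y hxy => ENNReal.ofReal_le_ofReal
      (hg.monotoneOn (tail_mem_Icc _ _) (tail_mem_Icc _ _) (antitone_tail _ hxy))
  refine le_trans (lintegral_mono fun x => ?_) (lintegral_liminf_le hmeas)
  -- Truncating at the limiting tail turns a lower bound on the lower limit into convergence, so
  -- that continuity of `g` applies; monotonicity of `g` then removes the truncation.
  let q : ℕ → ℝ := fun n => min (tail μ X x) (tail ν (Z n) x)
  have hq : ∀ n, q n ∈ Icc (0 : ℝ) 1 := fun n =>
    ⟨le_min (tail_mem_Icc X x).1 (tail_mem_Icc (Z n) x).1, min_le_of_left_le (tail_mem_Icc X x).2⟩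
  have hqlim : Tendsto q atTop (𝓝 (tail μ X x)) := by
    refine tendsto_order.2 ⟨fun c hc => ?_, fun c hc => ?_⟩
    · filter_upwards [h x c hc] with n hn using lt_min hc hn
    · exact Eventually.of_forall fun n => (min_le_left _ _).trans_lt hc
  have hglim : Tendsto (fun n => ENNReal.ofReal (g (q n))) atTop
      (𝓝 (ENNReal.ofReal (g (tail μ X x)))) :=
    ENNReal.tendsto_ofReal ((hgc _ (tail_mem_Icc X x)).tendsto.comp
      (tendsto_nhdsWithin_iff.2 ⟨hqlim, Eventually.of_forall hq⟩))
  rw [← hglim.liminf_eq]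
  exact liminf_le_liminf (Eventually.of_forall fun n => ENNReal.ofReal_le_ofReal
    (hg.monotoneOn (hq n) (tail_mem_Icc _ _) (min_le_right _ _)))

/-- The half-line above `x` is open, so `x < X ω` forces `x < Z k ω` for all large `k`. Continuity
from below along increasing sets holds for non-measurable sets too. -/
theorem eventually_lt_tail_of_tendsto {X : S → ℝ} {Z : ℕ → S → ℝ}
    (h : ∀ ω, Tendsto (fun n => Z n ω) atTop (𝓝 (X ω))) (x c : ℝ) (hc : c < tail μ X x) :
    ∀ᶠ n in atTop, c < tail μ (Z n) x := by
  let A : ℕ → Set S := fun n => ⋂ k ≥ n, {ω | x < Z k ω}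
  have hA : Monotone A := fun i j hij =>
    biInter_subset_biInter_left fun k (hk : j ≤ k) => hij.trans hk
  have hlim : Tendsto (fun n => μ.real (A n)) atTop (𝓝 (μ.real (⋃ n, A n))) :=
    (ENNReal.tendsto_toReal (measure_ne_top μ _)).comp (tendsto_measure_iUnion_atTop hA)
  have hsub : {ω | x < X ω} ⊆ ⋃ n, A n := by
    intro ω hω
    obtain ⟨n, hn⟩ := eventually_atTop.1 ((h ω).eventually (lt_mem_nhds hω))
    exact mem_iUnion.2 ⟨n, mem_iInter₂.2 hn⟩
  filter_upwards [hlim.eventually (lt_mem_nhds (hc.trans_le (measureReal_mono hsub)))] with n hn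
  exact hn.trans_le (measureReal_mono (biInter_subset_of_mem (le_refl n)))

/-- Right-continuity of the tail. It reduces the uncountably many levels `x` to rational ones, which
can be handled finitely many at a time. -/
theorem exists_rat_lt_tail {X : S → ℝ} {x c : ℝ} (hc : c < tail μ X x) :
    ∃ q : ℚ, x < q ∧ c < tail μ X q := by
  let A : ℕ → Set S := fun n => {ω | x + 1 / (n + 1) < X ω}
  have hA : Monotone A := fun i j hij ω hω =>
    lt_of_le_of_lt (by gcongr) (show x + 1 / ((i : ℝ) + 1) < X ω from hω)
  have hlim : Tendsto (fun n => μ.real (A n)) atTop (𝓝 (μ.real (⋃ n, A n))) :=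
    (ENNReal.tendsto_toReal (measure_ne_top μ _)).comp (tendsto_measure_iUnion_atTop hA)
  have hsub : {ω | x < X ω} ⊆ ⋃ n, A n := by
    intro ω (hω : x < X ω)
    obtain ⟨n, hn⟩ := exists_nat_one_div_lt (sub_pos.2 hω)
    exact mem_iUnion.2 ⟨n, show x + 1 / ((n : ℝ) + 1) < X ω by linarith⟩
  obtain ⟨n, hn⟩ := (hlim.eventually (lt_mem_nhds (hc.trans_le (measureReal_mono hsub)))).exists
  obtain ⟨q, hxq, hq⟩ := exists_rat_btwn
    (show x < x + 1 / ((n : ℝ) + 1) by have : 0 < 1 / ((n : ℝ) + 1) := by positivity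
                                       linarith)
  exact ⟨q, hxq, hn.trans_le (antitone_tail (μ := μ) X hq.le)⟩

end Tail

/-! ### Replacing a uniform randomization by labels -/

section Randomization

/-- The index of the interval `]j/(N+1), (j+1)/(N+1)]` containing `u` (with `0` in the first). -/
noncomputable def cellIndex (N : ℕ) (u : unitInterval) : ℕ := ⌈(u : ℝ) * (N + 1)⌉₊ - 1

/-- The left endpoint `j/(N+1)` of the `j`-th interval. -/
noncomputable def cellPoint (N j : ℕ) : unitInterval :=
  projIcc (0 : ℝ) 1 zero_le_one (j / (N + 1))

theorem cellIndex_lt (N : ℕ) (u : unitInterval) : cellIndex N u < N + 1 := by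
  have h : ⌈(u : ℝ) * (N + 1)⌉₊ ≤ N + 1 := by
    rw [Nat.ceil_le]
    push_cast
    exact mul_le_of_le_one_left (by positivity) u.2.2
  unfold cellIndex
  omega

theorem cellIndex_div_le (N : ℕ) (u : unitInterval) : (cellIndex N u : ℝ) / (N + 1) ≤ u := by
  rw [div_le_iff₀ (by positivity)]
  have h0 : 0 ≤ (u : ℝ) * (N + 1) := mul_nonneg u.2.1 (by positivity)
  have h1 := Nat.ceil_lt_add_one h0
  unfold cellIndex
  rcases Nat.eq_zero_or_pos ⌈(u : ℝ) * (N + 1)⌉₊ with h | h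
  · simpa [h] using h0
  · rw [Nat.cast_sub h]
    push_cast
    linarith

theorem le_cellIndex_div (N : ℕ) (u : unitInterval) :
    (u : ℝ) ≤ ((cellIndex N u : ℝ) + 1) / (N + 1) := by
  rw [le_div_iff₀ (by positivity)]
  refine (Nat.le_ceil _).trans ?_
  unfold cellIndex
  exact_mod_cast (by omega : ⌈(u : ℝ) * (N + 1)⌉₊ ≤ ⌈(u : ℝ) * (N + 1)⌉₊ - 1 + 1)

theorem volume_cellIndex_le (N j : ℕ) :
    (volume : Measure unitInterval).real {u | cellIndex N u = j} ≤ 1 / (N + 1) := by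
  have h0 : (0 : ℝ) ≤ 1 / (N + 1) := by positivity
  rw [measureReal_def]
  refine ENNReal.toReal_le_of_le_ofReal h0 ?_
  rw [unitInterval.volume_apply]
  refine (measure_mono (t := Icc ((j : ℝ) / (N + 1)) (((j : ℝ) + 1) / (N + 1))) ?_).trans ?_
  · rintro _ ⟨u, rfl, rfl⟩
    exact ⟨cellIndex_div_le N u, le_cellIndex_div N u⟩
  · rw [Real.volume_Icc]
    refine ENNReal.ofReal_le_ofReal (le_of_eq ?_)
    ring

theorem coe_cellPoint_cellIndex (N : ℕ) (u : unitInterval) :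
    (cellPoint N (cellIndex N u) : ℝ) = cellIndex N u / (N + 1) := by
  unfold cellPoint
  rw [projIcc_of_mem _ ⟨by positivity, (cellIndex_div_le N u).trans u.2.2⟩]

theorem cellPoint_cellIndex_le (N : ℕ) (u : unitInterval) : cellPoint N (cellIndex N u) ≤ u := by
  rw [← Subtype.coe_le_coe, coe_cellPoint_cellIndex]
  exact cellIndex_div_le N u

/-- Left endpoints are used so that the approach is from the side on which randomized stopping times
are continuous. -/
theorem tendsto_cellPoint_cellIndex (u : unitInterval) :
    Tendsto (fun N => cellPoint N (cellIndex N u)) atTop (𝓝[≤] u) := by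
  refine tendsto_nhdsWithin_iff.2 ⟨?_, Eventually.of_forall fun N => cellPoint_cellIndex_le N u⟩
  rw [tendsto_subtype_rng]
  have h1 : Tendsto (fun N : ℕ => (u : ℝ) - 1 / ((N : ℝ) + 1)) atTop (𝓝 u) := by
    simpa using tendsto_one_div_add_atTop_nhds_zero_nat.const_sub (u : ℝ)
  refine tendsto_of_tendsto_of_tendsto_of_le_of_le h1 tendsto_const_nhds (fun N => ?_) fun N => ?_
  · have := le_cellIndex_div N u
    rw [add_div] at this
    dsimp only
    rw [coe_cellPoint_cellIndex]
    linarith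
  · exact cellPoint_cellIndex_le N u

variable {Ω : Type*} {m mΩ : MeasurableSpace Ω} {P : Measure Ω} [IsProbabilityMeasure P]

/-- Covering by rectangles and subadditivity suffice, since the mixture is only bounded from above;
`sum_le_tail_labelled` is the matching lower bound for labels. -/
theorem tail_prod_cellIndex_le (X : ℕ → Ω → ℝ) (N : ℕ) (x : ℝ) :
    tail (P.prod (volume : Measure unitInterval)) (fun p => X (cellIndex N p.2) p.1) x ≤
      ∑ j ∈ Finset.range (N + 1), P.real {ω | x < X j ω} / (N + 1) := by
  have hsub : {p : Ω × unitInterval | x < X (cellIndex N p.2) p.1} ⊆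
      ⋃ j ∈ Finset.range (N + 1), {ω | x < X j ω} ×ˢ {u | cellIndex N u = j} := by
    intro p hp
    simp only [mem_iUnion]
    exact ⟨cellIndex N p.2, Finset.mem_range.2 (cellIndex_lt N p.2), hp, rfl⟩
  refine (measureReal_mono hsub (measure_ne_top _ _)).trans ((measureReal_biUnion_finset_le _ _).trans
    (Finset.sum_le_sum fun j _ => ?_))
  rw [measureReal_prod_prod, div_eq_mul_one_div]
  exact mul_le_mul_of_nonneg_left (volume_cellIndex_le N j) measureReal_nonneg

theorem sum_le_tail_labelled {X : ℕ → Ω → ℝ} (hX : ∀ j, Measurable (X j)) {V : Ω → ℕ}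
    (hV : Measurable V) (N : ℕ) (x : ℝ) :
    ∑ j ∈ Finset.range N, P.real (V ⁻¹' {j} ∩ {ω | x < X j ω}) ≤
      tail P (fun ω => X (V ω) ω) x := by
  rw [← measureReal_biUnion_finset]
  · refine measureReal_mono fun ω hω => ?_
    simp only [mem_iUnion] at hω
    obtain ⟨j, -, hVj, hj⟩ := hω
    obtain rfl : V ω = j := hVj
    exact hj
  · intro i _ j _ hij
    refine disjoint_left.2 fun ω hi hj => hij ?_
    exact (hi.1 : V ω = i).symm.trans hj.1
  · exact fun j _ => (hV (measurableSet_singleton j)).inter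
      (measurableSet_lt measurable_const (hX j))

/-- A randomization over finitely many variables can be replaced, in the limit, by labels that
are measurable with respect to an atomless σ-algebra. -/
theorem Atomless.exists_tailIntegral_le_liminf (h : Atomless P m) (hm : m ≤ mΩ) {g : ℝ → ℝ}
    (hg : IsDistortion g) (hgc : ContinuousOn g (Icc 0 1)) {X : ℕ → Ω → ℝ}
    (hX : ∀ j, Measurable (X j)) (N : ℕ) :
    ∃ V : ℕ → Ω → ℕ, (∀ n, Measurable[m] (V n)) ∧
      tailIntegral g (P.prod (volume : Measure unitInterval))
        (fun p => X (cellIndex N p.2) p.1) ≤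
      liminf (fun n => tailIntegral g P fun ω => X (V n ω) ω) atTop := by
  obtain ⟨q, hq⟩ := exists_surjective_nat ℚ
  -- Stage `n` handles the first `n` rational levels with error `1/(n+1)` per label. Each level is
  -- eventually included, and the `N+1` errors vanish together because `N` is fixed.
  have hex : ∀ n : ℕ, _ := fun n => h.exists_approx_uniform hm
    (fun p : Fin (N + 1) × Fin n => {ω | (q p.2 : ℝ) < X p.1 ω}) N.succ_pos n.succ_pos
  choose V hV hVD using hex
  refine ⟨V, hV, tailIntegral_le_liminf hg hgc fun x c hc => ?_⟩
  obtain ⟨r, hxr, hcr⟩ := exists_rat_lt_tail hc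
  obtain ⟨i, rfl⟩ := hq r
  have hlim : Tendsto (fun n : ℕ => ∑ j ∈ Finset.range (N + 1),
      (P.real {ω | (q i : ℝ) < X j ω} / (N + 1) - 1 / ((n : ℝ) + 1))) atTop
      (𝓝 (∑ j ∈ Finset.range (N + 1), P.real {ω | (q i : ℝ) < X j ω} / (N + 1))) := by
    refine tendsto_finsetSum _ fun j _ => ?_
    simpa using tendsto_one_div_add_atTop_nhds_zero_nat.const_sub
      (P.real {ω | (q i : ℝ) < X j ω} / (N + 1))
  filter_upwards [hlim.eventually (lt_mem_nhds (hcr.trans_le (tail_prod_cellIndex_le X N _))),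
    eventually_gt_atTop i] with n hn hin
  refine hn.trans_le (le_trans (Finset.sum_le_sum fun j hj => ?_)
    ((sum_le_tail_labelled hX ((hV n).mono hm le_rfl) (N + 1) (q i)).trans
      (antitone_tail _ hxr.le)))
  have := hVD n (⟨j, Finset.mem_range.1 hj⟩, ⟨i, hin⟩) j (Finset.mem_range.1 hj)
  push_cast at this
  exact this

end Randomization

/-! ### Time discretization -/

section Grid

variable {T : ℝ} (hT : 0 < T)

/-- The grid point `kT/(n+1)`, cut off at `T`. -/
noncomputable def gridPoint (n k : ℕ) : Icc (0 : ℝ) T := projIcc 0 T hT.le (k * (T / (n + 1)))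

/-- The index of the smallest positive grid point that is at least `t`. -/
noncomputable def gridIndex (n : ℕ) (t : Icc (0 : ℝ) T) : ℕ := max 1 ⌈(t : ℝ) / (T / (n + 1))⌉₊

/-- The smallest positive grid point that is at least `t`. -/
noncomputable def gridCeil (n : ℕ) (t : Icc (0 : ℝ) T) : Icc (0 : ℝ) T :=
  gridPoint hT n (gridIndex n t)

include hT in
theorem mesh_pos (n : ℕ) : 0 < T / ((n : ℝ) + 1) := by positivity

theorem coe_gridCeil (n : ℕ) (t : Icc (0 : ℝ) T) :
    (gridCeil hT n t : ℝ) = gridIndex n t * (T / (n + 1)) := by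
  have hδ := mesh_pos hT n
  unfold gridCeil gridPoint
  rw [projIcc_of_mem]
  refine ⟨by positivity, ?_⟩
  have h : gridIndex n t ≤ n + 1 := by
    refine max_le (by omega) (Nat.ceil_le.2 ?_)
    rw [div_le_iff₀ hδ]
    push_cast
    rw [mul_div_cancel₀ _ (by positivity)]
    exact t.2.2
  calc (gridIndex n t : ℝ) * (T / (n + 1)) ≤ ((n + 1 : ℕ) : ℝ) * (T / (n + 1)) := by gcongr
    _ = T := by push_cast; field_simp

theorem le_gridCeil (n : ℕ) (t : Icc (0 : ℝ) T) : t ≤ gridCeil hT n t := by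
  rw [← Subtype.coe_le_coe, coe_gridCeil, ← div_le_iff₀ (mesh_pos hT n)]
  exact (Nat.le_ceil _).trans (Nat.cast_le.2 (le_max_right _ _))

theorem mesh_le_gridCeil (n : ℕ) (t : Icc (0 : ℝ) T) : T / (n + 1) ≤ gridCeil hT n t := by
  rw [coe_gridCeil]
  have hδ := mesh_pos hT n
  have : (1 : ℝ) ≤ gridIndex n t := by exact_mod_cast le_max_left _ _
  nlinarith

theorem gridCeil_le_add (n : ℕ) (t : Icc (0 : ℝ) T) :
    (gridCeil hT n t : ℝ) ≤ t + T * (1 / (n + 1)) := by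
  have hδ := mesh_pos hT n
  have h0 : 0 ≤ (t : ℝ) / (T / (n + 1)) := div_nonneg t.2.1 hδ.le
  have h : (gridIndex n t : ℝ) ≤ t / (T / (n + 1)) + 1 := by
    unfold gridIndex
    rw [Nat.cast_max]
    exact max_le (by simpa using h0) (Nat.ceil_lt_add_one h0).le
  rw [coe_gridCeil]
  calc _ ≤ ((t : ℝ) / (T / (n + 1)) + 1) * (T / (n + 1)) := by gcongr
    _ = _ := by field_simp

theorem tendsto_gridCeil (t : Icc (0 : ℝ) T) :
    Tendsto (fun n => gridCeil hT n t) atTop (𝓝[≥] t) := by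
  refine tendsto_nhdsWithin_iff.2 ⟨?_, Eventually.of_forall fun n => le_gridCeil hT n t⟩
  rw [tendsto_subtype_rng]
  have h1 : Tendsto (fun n : ℕ => (t : ℝ) + T * (1 / ((n : ℝ) + 1))) atTop (𝓝 t) := by
    simpa using (tendsto_one_div_add_atTop_nhds_zero_nat.const_mul T).const_add (t : ℝ)
  exact tendsto_of_tendsto_of_tendsto_of_le_of_le tendsto_const_nhds h1
    (fun n => le_gridCeil hT n t) fun n => gridCeil_le_add hT n t

include hT in
-- The ceiling is left-continuous and integer-valued, hence eventually constant along any approach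
-- from the left.
theorem eventually_gridIndex_eq {n : ℕ} {t : Icc (0 : ℝ) T} {s : ℕ → Icc (0 : ℝ) T}
    (hs : Tendsto s atTop (𝓝 t)) (hle : ∀ N, s N ≤ t) :
    ∀ᶠ N in atTop, gridIndex n (s N) = gridIndex n t := by
  have hδ := mesh_pos hT n
  have hmono : ∀ N, gridIndex n (s N) ≤ gridIndex n t := fun N => by
    unfold gridIndex
    have : (s N : ℝ) ≤ t := hle N
    gcongr
  rcases Nat.eq_zero_or_pos ⌈(t : ℝ) / (T / (n + 1))⌉₊ with h0 | hpos
  · refine Eventually.of_forall fun N => (hmono N).antisymm ?_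
    simp [gridIndex, h0]
  · have hlt : ((⌈(t : ℝ) / (T / (n + 1))⌉₊ - 1 : ℕ) : ℝ) < t / (T / (n + 1)) :=
      Nat.lt_ceil.1 (by omega)
    have hlim : Tendsto (fun N => (s N : ℝ) / (T / (n + 1))) atTop (𝓝 (t / (T / (n + 1)))) :=
      ((continuous_subtype_val.tendsto t).comp hs).div_const _
    filter_upwards [hlim.eventually (lt_mem_nhds hlt)] with N hN
    have := Nat.lt_ceil.2 hN
    refine (hmono N).antisymm ?_
    unfold gridIndex
    omega

/-- Provides a positive time at which the σ-algebra is atomless and by which no rounded time has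
strictly passed, so that labels can be chosen there. -/
theorem exists_pos_le_gridCeil (n : ℕ) :
    ∃ t₀ : Icc (0 : ℝ) T, 0 < (t₀ : ℝ) ∧ ∀ t, t₀ ≤ gridCeil hT n t :=
  ⟨⟨T / (n + 1), (mesh_pos hT n).le, div_le_self hT.le (by simp)⟩, mesh_pos hT n,
    fun t => Subtype.coe_le_coe.1 (mesh_le_gridCeil hT n t)⟩

/-- Floor and ceiling are adjoint. This turns an event about the rounded time into one about the
original time at a grid point not after `s`, whence `gridCeil_mem_stoppingTimes`. -/
theorem gridCeil_le_iff (n : ℕ) (t s : Icc (0 : ℝ) T) :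
    gridCeil hT n t ≤ s ↔ T / (n + 1) ≤ (s : ℝ) ∧
      t ≤ gridPoint hT n ⌊(s : ℝ) / (T / (n + 1))⌋₊ := by
  have hδ := mesh_pos hT n
  have hs0 : 0 ≤ (s : ℝ) / (T / (n + 1)) := div_nonneg s.2.1 hδ.le
  have hfl : (⌊(s : ℝ) / (T / (n + 1))⌋₊ : ℝ) * (T / (n + 1)) ≤ s := by
    rw [← le_div_iff₀ hδ]
    exact Nat.floor_le hs0
  rw [← Subtype.coe_le_coe, ← Subtype.coe_le_coe, coe_gridCeil, gridPoint,
    projIcc_of_mem _ ⟨by positivity, hfl.trans s.2.2⟩, ← le_div_iff₀ hδ, ← Nat.le_floor_iff hs0,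
    gridIndex, max_le_iff, Nat.ceil_le, div_le_iff₀ hδ, Nat.le_floor_iff hs0, Nat.cast_one,
    le_div_iff₀ hδ, one_mul]

variable {Ω : Type*} {mΩ : MeasurableSpace Ω} {𝓕 : Filtration (Icc (0 : ℝ) T) mΩ}

theorem measurableSet_le_of_mem_stoppingTimes {τ : Ω → Icc (0 : ℝ) T} (hτ : τ ∈ stoppingTimes 𝓕)
    (t : Icc (0 : ℝ) T) : MeasurableSet[𝓕 t] {ω | τ ω ≤ t} := by
  simpa only [WithTop.coe_le_coe] using hτ t

theorem mem_stoppingTimes {τ : Ω → Icc (0 : ℝ) T}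
    (h : ∀ t, MeasurableSet[𝓕 t] {ω | τ ω ≤ t}) : τ ∈ stoppingTimes 𝓕 := fun t => by
  simpa only [WithTop.coe_le_coe] using h t

theorem measurable_of_mem_stoppingTimes {τ : Ω → Icc (0 : ℝ) T} (hτ : τ ∈ stoppingTimes 𝓕) :
    Measurable τ :=
  measurable_of_Iic fun t => 𝓕.le t _ (measurableSet_le_of_mem_stoppingTimes hτ t)

theorem gridCeil_mem_stoppingTimes (n : ℕ) {τ : Ω → Icc (0 : ℝ) T} (hτ : τ ∈ stoppingTimes 𝓕) :
    (fun ω => gridCeil hT n (τ ω)) ∈ stoppingTimes 𝓕 := by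
  refine mem_stoppingTimes fun s => ?_
  by_cases hs : T / ((n : ℝ) + 1) ≤ s
  · simp only [gridCeil_le_iff, hs, true_and]
    have hδ := mesh_pos hT n
    refine 𝓕.mono ?_ _ (measurableSet_le_of_mem_stoppingTimes hτ
      (gridPoint hT n ⌊(s : ℝ) / (T / (n + 1))⌋₊))
    have hfl : (⌊(s : ℝ) / (T / (n + 1))⌋₊ : ℝ) * (T / (n + 1)) ≤ s := by
      rw [← le_div_iff₀ hδ]
      exact Nat.floor_le (div_nonneg s.2.1 hδ.le)
    rw [← Subtype.coe_le_coe, gridPoint, projIcc_of_mem _ ⟨by positivity, hfl.trans s.2.2⟩]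
    exact hfl
  · simp [gridCeil_le_iff, hs]

theorem tendsto_comp_gridCeil {y : Icc (0 : ℝ) T → ℝ} {t : Icc (0 : ℝ) T}
    (hy : ContinuousWithinAt y (Ici t) t) :
    Tendsto (fun n => y (gridCeil hT n t)) atTop (𝓝 (y t)) :=
  Tendsto.comp (g := y) hy (tendsto_gridCeil hT t)

/-- A right-continuous process evaluated at a random time is a random variable. -/
theorem measurable_stopped {Y : Icc (0 : ℝ) T → Ω → ℝ} (hY : ∀ t, Measurable (Y t))
    (hY_right : ∀ ω t, ContinuousWithinAt (fun s => Y s ω) (Ici t) t)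
    {τ : Ω → Icc (0 : ℝ) T} (hτ : Measurable τ) (hT : 0 < T) : Measurable fun ω => Y (τ ω) ω := by
  have hlim : Tendsto (fun n ω => Y (gridCeil hT n (τ ω)) ω) atTop (𝓝 fun ω => Y (τ ω) ω) :=
    tendsto_pi_nhds.2 fun ω => tendsto_comp_gridCeil hT (hY_right ω (τ ω))
  refine measurable_of_tendsto_metrizable (fun n => ?_) hlim
  have hidx : Measurable fun ω => gridIndex n (τ ω) :=
    measurable_const.max (Nat.measurable_ceil.comp
      ((measurable_subtype_coe.comp hτ).div_const _))
  have hY' : Measurable fun p : ℕ × Ω => Y (gridPoint hT n p.1) p.2 := by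
    apply measurable_from_prod_countable_right
    exact fun k => hY (gridPoint hT n k)
  have hcomp := hY'.comp (hidx.prodMk measurable_id)
  exact hcomp

/-- Selecting among stopping times `σ j ≥ t₀` by an `𝓕 t₀`-measurable label gives a stopping
time. -/
theorem select_mem_stoppingTimes {σ : ℕ → Ω → Icc (0 : ℝ) T} (hσ : ∀ j, σ j ∈ stoppingTimes 𝓕)
    {t₀ : Icc (0 : ℝ) T} (ht₀ : ∀ j ω, t₀ ≤ σ j ω) {V : Ω → ℕ} (hV : Measurable[𝓕 t₀] V) :
    (fun ω => σ (V ω) ω) ∈ stoppingTimes 𝓕 := by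
  refine mem_stoppingTimes fun t => ?_
  by_cases ht : t₀ ≤ t
  · have : {ω | σ (V ω) ω ≤ t} = ⋃ j, V ⁻¹' {j} ∩ {ω | σ j ω ≤ t} := by
      ext ω
      simp
    rw [this]
    exact MeasurableSet.iUnion fun j => MeasurableSet.inter
      (𝓕.mono ht _ (hV (measurableSet_singleton j)))
      (measurableSet_le_of_mem_stoppingTimes (hσ j) t)
  · have : {ω | σ (V ω) ω ≤ t} = ∅ := by
      ext ω
      simpa using (not_le.1 ht).trans_le (ht₀ (V ω) ω)
    rw [this]
    exact @MeasurableSet.empty _ (𝓕 t)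

end Grid

/-! ### Randomized stopping times -/

section Randomized

variable {Ω : Type*} {mΩ : MeasurableSpace Ω} {P : Measure Ω} {T : ℝ}
  {𝓕 : Filtration (Icc (0 : ℝ) T) mΩ} {Y : Icc (0 : ℝ) T → Ω → ℝ} {g : ℝ → ℝ}

theorem distortedExp_prod_fst (X : Ω → ℝ) :
    distortedExp g (P.prod (volume : Measure unitInterval)) (fun p => X p.1) =
      distortedExp g P X := by
  have h : distFun (P.prod (volume : Measure unitInterval)) (fun p => X p.1) = distFun P X := by
    funext x
    have : {p : Ω × unitInterval | X p.1 ≤ x} = {ω | X ω ≤ x} ×ˢ univ := by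
      ext p
      simp
    rw [distFun, this, measureReal_prod_prod, probReal_univ, mul_one, distFun]
  rw [distortedExp, distortedExp, h]

variable [IsProbabilityMeasure P]

/-- A finite randomization among stopping times bounded away from `0` is no better than the best
stopping time. -/
theorem tailIntegral_finite_randomization_le (hT : 0 < T) (hY : ∀ t, Measurable (Y t))
    (hY_right : ∀ ω t, ContinuousWithinAt (fun s => Y s ω) (Ici t) t)
    (hg : IsDistortion g) (hgc : ContinuousOn g (Icc 0 1))
    (h_atomless : ∀ t : Icc (0 : ℝ) T, 0 < (t : ℝ) → Atomless P (𝓕 t))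
    {s : ℝ≥0∞} (hs : ∀ τ ∈ stoppingTimes 𝓕, tailIntegral g P (fun ω => Y (τ ω) ω) ≤ s)
    {σ : ℕ → Ω → Icc (0 : ℝ) T} (hσ : ∀ j, σ j ∈ stoppingTimes 𝓕)
    {t₀ : Icc (0 : ℝ) T} (ht₀pos : 0 < (t₀ : ℝ)) (ht₀ : ∀ j ω, t₀ ≤ σ j ω) (N : ℕ) :
    tailIntegral g (P.prod (volume : Measure unitInterval))
      (fun p => Y (σ (cellIndex N p.2) p.1) p.1) ≤ s := by
  obtain ⟨V, hV, hle⟩ := (h_atomless t₀ ht₀pos).exists_tailIntegral_le_liminf (𝓕.le t₀) hg hgc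
    (X := fun j ω => Y (σ j ω) ω) (fun j => measurable_stopped hY hY_right
      (measurable_of_mem_stoppingTimes (hσ j)) hT) N
  have hbd : ∀ k, tailIntegral g P (fun ω => Y (σ (V k ω) ω) ω) ≤ s := fun k =>
    hs _ (select_mem_stoppingTimes hσ ht₀ (hV k))
  exact hle.trans (liminf_le_of_frequently_le' (Frequently.of_forall hbd))

theorem tailIntegral_le_of_tendsto {S : Type*} [MeasurableSpace S] {μ : Measure S}
    [IsProbabilityMeasure μ] (hg : IsDistortion g) (hgc : ContinuousOn g (Icc 0 1))
    {X : S → ℝ} {Z : ℕ → S → ℝ} (h : ∀ ω, Tendsto (fun n => Z n ω) atTop (𝓝 (X ω)))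
    {s : ℝ≥0∞} (hs : ∀ n, tailIntegral g μ (Z n) ≤ s) : tailIntegral g μ X ≤ s :=
  (tailIntegral_le_liminf hg hgc (eventually_lt_tail_of_tendsto h)).trans
    (liminf_le_of_frequently_le' (Frequently.of_forall hs))

/-- Here `y` is arbitrary: rounding to a fixed grid makes the sequence eventually constant, whereas
a right-continuous path need not respect the left limit in `u` directly. -/
theorem tendsto_gridCeil_cellPoint (hT : 0 < T) (n : ℕ) {t : unitInterval → Icc (0 : ℝ) T}
    (ht : Monotone t) {u : unitInterval} (htu : ContinuousWithinAt t (Iic u) u)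
    (y : Icc (0 : ℝ) T → ℝ) :
    Tendsto (fun N => y (gridCeil hT n (t (cellPoint N (cellIndex N u))))) atTop
      (𝓝 (y (gridCeil hT n (t u)))) := by
  have hlim : Tendsto (fun N => t (cellPoint N (cellIndex N u))) atTop (𝓝 (t u)) :=
    Tendsto.comp (g := t) htu (tendsto_cellPoint_cellIndex u)
  refine tendsto_const_nhds.congr' ?_
  filter_upwards [eventually_gridIndex_eq hT (n := n) hlim
    fun N => ht (cellPoint_cellIndex_le N u)] with N hN
  simp only [gridCeil]
  rw [hN]

theorem tailIntegral_randomized_le (hT : 0 < T) (hY : ∀ t, Measurable (Y t))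
    (hY_right : ∀ ω t, ContinuousWithinAt (fun s => Y s ω) (Ici t) t)
    (hg : IsDistortion g) (hgc : ContinuousOn g (Icc 0 1))
    (h_atomless : ∀ t : Icc (0 : ℝ) T, 0 < (t : ℝ) → Atomless P (𝓕 t))
    {s : ℝ≥0∞} (hs : ∀ τ ∈ stoppingTimes 𝓕, tailIntegral g P (fun ω => Y (τ ω) ω) ≤ s)
    {τ : Ω → unitInterval → Icc (0 : ℝ) T} (hτ : τ ∈ randomizedStoppingTimes 𝓕) :
    tailIntegral g (P.prod (volume : Measure unitInterval))
      (fun p : Ω × unitInterval => Y (τ p.1 p.2) p.1) ≤ s := by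
  obtain ⟨hmono, hleft, hbranch⟩ := hτ
  have hfinite : ∀ n N : ℕ, tailIntegral g (P.prod (volume : Measure unitInterval))
      (fun p => Y (gridCeil hT n (τ p.1 (cellPoint N (cellIndex N p.2)))) p.1) ≤ s := by
    intro n N
    obtain ⟨t₀, ht₀pos, ht₀⟩ := exists_pos_le_gridCeil hT n
    have hσ : ∀ j, (fun ω => gridCeil hT n (τ ω (cellPoint N j))) ∈ stoppingTimes 𝓕 := fun j =>
      gridCeil_mem_stoppingTimes hT n (hbranch (cellPoint N j))
    exact tailIntegral_finite_randomization_le hT hY hY_right hg hgc h_atomless hs hσ ht₀pos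
      (fun j ω => ht₀ (τ ω (cellPoint N j))) N
  have hlim : ∀ (n : ℕ) (p : Ω × unitInterval), Tendsto
      (fun N => Y (gridCeil hT n (τ p.1 (cellPoint N (cellIndex N p.2)))) p.1) atTop
      (𝓝 (Y (gridCeil hT n (τ p.1 p.2)) p.1)) := fun n p =>
    tendsto_gridCeil_cellPoint hT n (hmono p.1) (hleft p.1 p.2) fun t => Y t p.1
  have hlim' : ∀ p : Ω × unitInterval, Tendsto (fun n => Y (gridCeil hT n (τ p.1 p.2)) p.1) atTop
      (𝓝 (Y (τ p.1 p.2) p.1)) := fun p =>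
    tendsto_comp_gridCeil (y := fun t => Y t p.1) hT (hY_right p.1 (τ p.1 p.2))
  have hgrid : ∀ n : ℕ, tailIntegral g (P.prod (volume : Measure unitInterval))
      (fun p => Y (gridCeil hT n (τ p.1 p.2)) p.1) ≤ s := fun n =>
    tailIntegral_le_of_tendsto hg hgc (hlim n) (hfinite n)
  exact tailIntegral_le_of_tendsto hg hgc hlim' hgrid

end Randomized

end DistortedStopping

theorem proposition4p3 {Ω : Type*} {mΩ : MeasurableSpace Ω} (P : Measure Ω)
    [IsProbabilityMeasure P] (T : ℝ) (hT : 0 < T)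
    -- the filtration
    (𝓕 : Filtration (Icc (0 : ℝ) T) mΩ) (h𝓕_right : 𝓕.IsRightContinuous)
    (h𝓕_trivial : ∀ t : Icc (0 : ℝ) T, (t : ℝ) = 0 →
      ∀ A, MeasurableSet[𝓕 t] A → P A = 0 ∨ P A = 1)
    (h𝓕_null : ∀ t : Icc (0 : ℝ) T, (t : ℝ) = 0 →
      ∀ A, MeasurableSet[mΩ] A → P A = 0 → MeasurableSet[𝓕 t] A)
    -- the reward process
    (Y : Icc (0 : ℝ) T → Ω → ℝ) (hY_adapted : Adapted 𝓕 Y)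
    (hY_nonneg : ∀ t ω, 0 ≤ Y t ω)
    (hY_right : ∀ ω t, ContinuousWithinAt (fun s => Y s ω) (Ici t) t)
    (hY_bdd : ∀ ω, BddAbove (range fun t => Y t ω))
    -- the distortion function
    (g : ℝ → ℝ) (hg : DistortedStopping.IsDistortion g)
    (hg_cont : ContinuousOn g (Icc 0 1)) (hg_concave : ConcaveOn ℝ (Icc 0 1) g)
    -- the hypotheses of the result
    (h_atomless : ∀ t : Icc (0 : ℝ) T, 0 < (t : ℝ) → DistortedStopping.Atomless P (𝓕 t))
    (h_ctbl : ∀ t : Icc (0 : ℝ) T, 0 < (t : ℝ) →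
      DistortedStopping.CountablyGeneratedModNull P (𝓕 t))
    (hYstar : (fun ω => ⨆ t, Y t ω) ∈ DistortedStopping.spaceX g P) :
    (⨆ τ ∈ DistortedStopping.randomizedStoppingTimes 𝓕,
      DistortedStopping.distortedExp g (P.prod (volume : Measure unitInterval))
        (fun p : Ω × unitInterval => Y (τ p.1 p.2) p.1)) =
    ⨆ τ ∈ DistortedStopping.stoppingTimes 𝓕,
      DistortedStopping.distortedExp g P (fun ω => Y (τ ω) ω) := by
  have hYm : ∀ t, Measurable (Y t) := fun t => (hY_adapted t).mono (𝓕.le t) le_rfl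
  refine le_antisymm (iSup₂_le fun τ hτ => ?_) (iSup₂_le fun τ hτ => ?_)
  · refine (DistortedStopping.distortedExp_le_tailIntegral hg fun p => hY_nonneg _ _).trans ?_
    refine le_trans (EReal.coe_ennreal_le_coe_ennreal_iff.2
      (DistortedStopping.tailIntegral_randomized_le (s := (⨆ σ ∈ DistortedStopping.stoppingTimes 𝓕,
        DistortedStopping.tailIntegral g P (fun ω => Y (σ ω) ω))) hT hYm hY_right hg hg_cont
        h_atomless (fun σ hσ => le_iSup₂_of_le σ hσ le_rfl) hτ)) ?_
    have hle : ∀ σ ∈ DistortedStopping.stoppingTimes 𝓕,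
        (DistortedStopping.tailIntegral g P (fun ω => Y (σ ω) ω) : EReal) ≤
          ⨆ τ ∈ DistortedStopping.stoppingTimes 𝓕,
            DistortedStopping.distortedExp g P (fun ω => Y (τ ω) ω) := fun σ hσ => by
      rw [← DistortedStopping.distortedExp_eq_tailIntegral hg (fun ω => hY_nonneg _ _)
        (DistortedStopping.measurable_stopped hYm hY_right
          (DistortedStopping.measurable_of_mem_stoppingTimes hσ) hT)]
      exact le_iSup₂ (f := fun τ (_ : τ ∈ DistortedStopping.stoppingTimes 𝓕) =>
        DistortedStopping.distortedExp g P (fun ω => Y (τ ω) ω)) σ hσ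
    -- Nonemptiness of the family: an empty supremum in `EReal` would be `⊥`. With one member the
    -- supremum is nonnegative, so the comparison can be carried out in `ℝ≥0∞`.
    have hconst : (fun _ : Ω => (⟨0, le_rfl, hT.le⟩ : Icc (0 : ℝ) T)) ∈
        DistortedStopping.stoppingTimes 𝓕 := isStoppingTime_const 𝓕 _
    rw [← EReal.coe_toENNReal ((EReal.coe_ennreal_nonneg _).trans (hle _ hconst)),
      EReal.coe_ennreal_le_coe_ennreal_iff]
    refine iSup₂_le fun σ hσ => ?_
    simpa using EReal.toENNReal_le_toENNReal (hle σ hσ)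
  · rw [← DistortedStopping.distortedExp_prod_fst]
    exact le_iSup₂ (f := fun (τ : Ω → unitInterval → Icc (0 : ℝ) T)
      (_ : τ ∈ DistortedStopping.randomizedStoppingTimes 𝓕) =>
      DistortedStopping.distortedExp g (P.prod (volume : Measure unitInterval))
        (fun p : Ω × unitInterval => Y (τ p.1 p.2) p.1)) (fun ω _ => τ ω)
      ⟨fun ω => monotone_const, fun ω u => continuousWithinAt_const, fun _ => hτ⟩
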